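/- Let $R$ be a commutative ring, $a=(a_k)_{k\in\mathbb Z}$ a doubly infinite sequence of elements of $R$, and $x=(x_1,\dots,x_n)$ independent variables over $R$ ($n\ge 0$). For $r\in\mathbb Z$ let $\tau^r a$ be the sequence with $(\tau^r a)_k=a_{k+r}$, and for $r\ge 0$ put $(x_i\mid a)^r=\prod_{k=1}^{r}(x_i+a_k)$. For $\alpha\in\mathbb N^n$ let $A_\alpha(x\mid a)=\det\bigl((x_i\mid a)^{\alpha_j}\bigr)_{1\le i,j\le n}$, and let $\delta=(n-1,n-2,\dots,0)$. For a partition $\lambda$ of length $\ell(\lambda)\le n$, the factorial Schur polynomial is $$s_\lambda(x\mid a)=A_{\lambda+\delta}(x\mid a)/A_\delta(x\mid a)\in R[x_1,\dots,x_n].$$ Put $h_r(x\mid a)=s_{(r)}(x\mid a)$ for $r\ge0$ (to be read as $0$ if $n=0<r$) and $h_r(x\mid a)=0$ for $r<0$; put $e_r(x\mid a)=s_{(1^r)}(x\mid a)$ for $0\le r\le n$ and $e_r(x\mid a)=0$ for all other $r\in\mathbb Z$. For arbitrary partitions $\lambda,\mu$ the skew factorial Schur polynomial is $$s_{\lambda/\mu}(x\mid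 a)=\det\Bigl(h_{\lambda_i-\mu_j-i+j}\bigl(x\mid\tau^{\mu_j-j+1}a\bigr)\Bigr)_{1\le i,j\le m},$$ where $m$ is any integer with $m\ge\ell(\lambda)$ and $m\ge\ell(\mu)$ (the determinant does not depend on $m$). Then, writing $\lambda',\mu'$ for the conjugate partitions, for all partitions $\lambda,\mu$ and every integer $p\ge\max(\lambda_1,\mu_1)$, $$s_{\lambda/\mu}(x\mid a)=\det\Bigl(e_{\lambda'_i-\mu'_j-i+j}\bigl(x\mid\tau^{-\mu'_j+j-1}a\bigr)\Bigr)_{1\le i,j\le p}.$$ Moreover, for every partition $\lambda$ with $\ell(\lambda)\le n$ and every integer $p\ge\lambda_1$, $$s_{\lambda}(x\mid a)=\det\Bigl(e_{\lambda'_i-i+j}\bigl(x\mid\tau^{j-1}a\bigr)\Bigr)_{1\le i,j\le p}.$$ -/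

import Mathlib

open MvPolynomial

namespace FactorialSchur

/-- The shift `τ^r` on doubly infinite sequences: `(τ^r a)_k = a_{k+r}`. -/
def shift {R : Type*} (r : ℤ) (a : ℤ → R) : ℤ → R := fun k => a (k + r)

/-- The factorial power `(x_i | a)^r = (x_i + a_1)(x_i + a_2) ⋯ (x_i + a_r)`. -/
noncomputable def factorialPower {R : Type*} [CommRing R] (n : ℕ) (a : ℤ → R) (i : Fin n) (r : ℕ) :
    MvPolynomial (Fin n) R :=
  ∏ k ∈ Finset.Icc 1 r, (X i + C (a (k : ℤ)))

/-- The alternant `A_α(x | a) = det ((x_i | a)^{α_j})_{1 ≤ i, j ≤ n}`. -/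
noncomputable def alternant {R : Type*} [CommRing R] (n : ℕ) (a : ℤ → R) (α : Fin n → ℕ) :
    MvPolynomial (Fin n) R :=
  (Matrix.of fun i j : Fin n => factorialPower n a i (α j)).det

/-- The exponent vector `δ = (n - 1, n - 2, …, 1, 0)`. -/
def delta (n : ℕ) : Fin n → ℕ := fun j => n - 1 - (j : ℕ)

theorem prod_sub_dvd_det_eval {S : Type*} [CommRing S] (n : ℕ) :
    ∀ (v : Fin n → S) (P : Fin n → Polynomial S),
      (∏ i : Fin n, ∏ j ∈ Finset.Ioi i, (v j - v i)) ∣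
        (Matrix.of fun i j : Fin n => (P j).eval (v i)).det := by
  induction n with
  | zero => intro v P; simp
  | succ n ih =>
    intro v P
    have hQ : ∀ j, ∃ Q : Polynomial S,
        P j - Polynomial.C ((P j).eval (v 0)) = (Polynomial.X - Polynomial.C (v 0)) * Q :=
      fun j => Polynomial.X_sub_C_dvd_sub_C_eval
    choose Q hQ using hQ
    have hQ' : ∀ i j, (P j).eval (v i) = (v i - v 0) * (Q j).eval (v i) + (P j).eval (v 0) := by
      intro i j
      have := congrArg (Polynomial.eval (v i)) (hQ j)
      simp only [Polynomial.eval_sub, Polynomial.eval_mul, Polynomial.eval_C,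
        Polynomial.eval_X] at this
      linear_combination this
    let B : Matrix (Fin (n + 1)) (Fin (n + 1)) S := Matrix.of fun i j =>
      (Fin.cons (P j |>.eval (v 0)) (fun i' : Fin n =>
        (v i'.succ - v 0) * (Q j).eval (v i'.succ)) : Fin (n + 1) → S) i
    have hdet : (Matrix.of fun i j : Fin (n + 1) => (P j).eval (v i)).det = B.det := by
      refine Matrix.det_eq_of_forall_row_eq_smul_add_const
        (Fin.cons 0 (fun _ => 1) : Fin (n + 1) → S) 0 (by simp) ?_
      intro i j
      refine Fin.cases ?_ (fun i' => ?_) i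
      · simp [B]
      · simp [B, hQ' i'.succ j]
    rw [hdet, Matrix.det_succ_row_zero]
    refine Finset.dvd_sum fun j _ => ?_
    have hsub : (B.submatrix Fin.succ j.succAbove).det =
        (∏ i : Fin n, (v i.succ - v 0)) *
          (Matrix.of fun i k : Fin n => (Q (j.succAbove k)).eval (v i.succ)).det := by
      rw [← Matrix.det_mul_column]
      congr 1
    rw [hsub, Fin.prod_univ_succ]
    have h1 : (∏ j ∈ Finset.Ioi (0 : Fin (n + 1)), (v j - v 0)) =
        ∏ i : Fin n, (v i.succ - v 0) := by
      rw [Fin.Ioi_zero_eq_map, Finset.prod_map]; simp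
    have h2 : (∏ i : Fin n, ∏ j ∈ Finset.Ioi i.succ, (v j - v i.succ)) =
        ∏ i : Fin n, ∏ j ∈ Finset.Ioi i, (v j.succ - v i.succ) := by
      refine Finset.prod_congr rfl fun i _ => ?_
      rw [Fin.prod_Ioi_succ]
    rw [h1, h2]
    exact Dvd.dvd.mul_left (mul_dvd_mul_left _ (ih (fun i => v i.succ) _)) _

theorem isRegular_X_sub_X {R : Type*} [CommRing R] {σ : Type*} {i j : σ} (hij : i ≠ j) :
    IsRegular (X i - X j : MvPolynomial σ R) := by
  classical
  let f : MvPolynomial σ R →ₐ[R] MvPolynomial σ R :=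
    aeval (fun k => if k = i then X i + X j else X k)
  let g : MvPolynomial σ R →ₐ[R] MvPolynomial σ R :=
    aeval (fun k => if k = i then X i - X j else X k)
  have hgf : g.comp f = AlgHom.id R _ := by
    ext1 k
    by_cases hk : k = i
    · subst hk; simp [f, g, hij.symm]
    · simp [f, g, hk]
  have hinj : Function.Injective f :=
    Function.LeftInverse.injective (g := g) fun p => DFunLike.congr_fun hgf p
  have hfx : f (X i - X j) = X i := by simp [f, hij.symm]
  rw [Commute.isRegular_iff (fun b => Commute.all _ b)]
  intro p q hpq
  have h : f ((X i - X j) * p) = f ((X i - X j) * q) := congrArg f hpq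
  rw [map_mul, map_mul, hfx] at h
  exact hinj ((isRegular_X (R := R) (n := i)).left h)

theorem factorialPower_eq_eval {R : Type*} [CommRing R] (n : ℕ) (a : ℤ → R) (i : Fin n) (r : ℕ) :
    factorialPower n a i r = (∏ k ∈ Finset.Icc 1 r,
      (Polynomial.X + Polynomial.C (C (a (k : ℤ)) : MvPolynomial (Fin n) R))).eval (X i) := by
  simp [factorialPower, Polynomial.eval_prod]

theorem alternant_delta {R : Type*} [CommRing R] (n : ℕ) (a : ℤ → R) :
    Associated (∏ i : Fin n, ∏ j ∈ Finset.Ioi i, (X j - X i : MvPolynomial (Fin n) R))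
      (alternant n a (delta n)) := by
  rcases subsingleton_or_nontrivial R with hR | hR
  · rw [Subsingleton.elim (alternant n a (delta n)) _]
  have hmon : ∀ r : ℕ, (∏ k ∈ Finset.Icc 1 r, (Polynomial.X +
      Polynomial.C (C (a (k : ℤ)) : MvPolynomial (Fin n) R))).Monic := fun r =>
    Polynomial.monic_prod_of_monic _ _ fun k _ => Polynomial.monic_X_add_C _
  have hdeg : ∀ r : ℕ, (∏ k ∈ Finset.Icc 1 r, (Polynomial.X +
      Polynomial.C (C (a (k : ℤ)) : MvPolynomial (Fin n) R))).natDegree = r := fun r => by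
    rw [Polynomial.natDegree_prod_of_monic _ _ fun k _ => Polynomial.monic_X_add_C _]
    simp
  have key := Matrix.det_eval_matrixOfPolynomials_eq_det_vandermonde
    (fun i : Fin n => (X i : MvPolynomial (Fin n) R))
    (fun j : Fin n => ∏ k ∈ Finset.Icc 1 (j : ℕ), (Polynomial.X +
      Polynomial.C (C (a (k : ℤ)) : MvPolynomial (Fin n) R)))
    (fun j => hdeg j) (fun j => hmon j)
  rw [Matrix.det_vandermonde] at key
  rw [key]
  have hperm : alternant n a (delta n) = ((Equiv.Perm.sign (Fin.revPerm (n := n)) : ℤˣ) : ℤ) *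
      (Matrix.of fun i j : Fin n => (∏ k ∈ Finset.Icc 1 (j : ℕ), (Polynomial.X +
        Polynomial.C (C (a (k : ℤ)) : MvPolynomial (Fin n) R))).eval (X i)).det := by
    rw [← Matrix.det_permute']
    unfold alternant
    congr 1
    ext1 i j
    simp only [Matrix.of_apply, Matrix.submatrix_apply, factorialPower_eq_eval, delta, id]
    congr 3
    simp [Fin.val_rev]; omega
  rw [hperm]
  refine (associated_unit_mul_left _ _ ?_).symm
  exact (Units.map (Int.castRingHom (MvPolynomial (Fin n) R)).toMonoidHom
    (Equiv.Perm.sign (Fin.revPerm (n := n)))).isUnit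

/-- `A_δ(x | a)` is cancellable and divides every alternant `A_α(x | a)`, so the quotient
`A_α(x | a) / A_δ(x | a)` is a well-defined polynomial. -/
theorem existsUnique_quotient {R : Type*} [CommRing R] (n : ℕ) (a : ℤ → R) (α : Fin n → ℕ) :
    ∃! s : MvPolynomial (Fin n) R, alternant n a (delta n) * s = alternant n a α := by
  have hass := alternant_delta n a
  have hdvd : alternant n a (delta n) ∣ alternant n a α := by
    refine hass.symm.dvd.trans ?_
    have := prod_sub_dvd_det_eval n (fun i : Fin n => (X i : MvPolynomial (Fin n) R))
      (fun j => ∏ k ∈ Finset.Icc 1 (α j), (Polynomial.X +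
        Polynomial.C (C (a (k : ℤ)) : MvPolynomial (Fin n) R)))
    simpa only [alternant, factorialPower_eq_eval] using this
  have hreg : IsRegular (alternant n a (delta n)) := by
    obtain ⟨u, hu⟩ := hass
    rw [← hu]
    refine IsRegular.mul ?_ u.isRegular
    refine IsRegular.prod fun i _ => IsRegular.prod fun j hj => ?_
    exact isRegular_X_sub_X (Finset.mem_Ioi.mp hj).ne'
  obtain ⟨s, hs⟩ := hdvd
  exact ⟨s, hs.symm, fun t ht => hreg.left (ht.trans hs)⟩

/-- The factorial Schur polynomial `s_λ(x | a) = A_{λ+δ}(x | a) / A_δ(x | a)` in the variables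
`x = (x_1, …, x_n)`, where `ℓ(λ) ≤ n`; it is `0` for partitions `λ` of length `> n`.
In a Young diagram `λ`, the part `λ_{i+1}` is `λ.rowLen i`, the part `λ'_{i+1}` of the conjugate
partition is `λ.colLen i`, and the length `ℓ(λ)` is `λ.colLen 0`. -/
noncomputable def factorialSchur {R : Type*} [CommRing R] (n : ℕ) (lam : YoungDiagram)
    (a : ℤ → R) : MvPolynomial (Fin n) R :=
  if lam.colLen 0 ≤ n then
    (existsUnique_quotient n a (fun j => lam.rowLen j + delta n j)).choose
  else 0

theorem factorialSchur_spec {R : Type*} [CommRing R] (n : ℕ) (lam : YoungDiagram) (a : ℤ → R)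
    (h : lam.colLen 0 ≤ n) :
    alternant n a (delta n) * factorialSchur n lam a =
      alternant n a (fun j => lam.rowLen j + delta n j) := by
  rw [factorialSchur, if_pos h]
  exact (existsUnique_quotient n a (fun j => lam.rowLen j + delta n j)).choose_spec.1

/-- The partition `(r)`, whose Young diagram is a single row of `r` cells. -/
def oneRow (r : ℕ) : YoungDiagram := YoungDiagram.ofRowLens [r] (by simp [List.sortedGE_iff_pairwise])

/-- The partition `(1^r)`, whose Young diagram is a single column of `r` cells. -/
def oneColumn (r : ℕ) : YoungDiagram := (oneRow r).transpose

/-- `h_r(x | a) = s_{(r)}(x | a)` for `r ≥ 0` (so `h_r = 0` when `n = 0 < r`), and `h_r(x | a) = 0`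
for `r < 0`. -/
noncomputable def h {R : Type*} [CommRing R] (n : ℕ) (r : ℤ) (a : ℤ → R) :
    MvPolynomial (Fin n) R :=
  if 0 ≤ r then factorialSchur n (oneRow r.toNat) a else 0

/-- `e_r(x | a) = s_{(1^r)}(x | a)` for `0 ≤ r ≤ n`, and `e_r(x | a) = 0` for `r < 0` or `r > n`. -/
noncomputable def e {R : Type*} [CommRing R] (n : ℕ) (r : ℤ) (a : ℤ → R) :
    MvPolynomial (Fin n) R :=
  if 0 ≤ r ∧ r ≤ n then factorialSchur n (oneColumn r.toNat) a else 0

/-- The `m × m` matrix `(h_{λ_i - μ_j - i + j}(x | τ^{μ_j - j + 1} a))_{1 ≤ i, j ≤ m}`; the indices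
`i, j : Fin m` below stand for `i + 1` and `j + 1`. -/
noncomputable def hMatrix {R : Type*} [CommRing R] (n : ℕ) (lam mu : YoungDiagram) (a : ℤ → R)
    (m : ℕ) : Matrix (Fin m) (Fin m) (MvPolynomial (Fin n) R) :=
  Matrix.of fun i j : Fin m =>
    h n ((lam.rowLen i : ℤ) - mu.rowLen j - ((i : ℤ) + 1) + ((j : ℤ) + 1))
      (shift ((mu.rowLen j : ℤ) - ((j : ℤ) + 1) + 1) a)

/-- The skew factorial Schur polynomial
`s_{λ/μ}(x | a) = det (h_{λ_i - μ_j - i + j}(x | τ^{μ_j - j + 1} a))_{1 ≤ i, j ≤ m}`, taken with the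
least `m` such that `ℓ(λ) ≤ m` and `ℓ(μ) ≤ m`; every larger `m` gives the same determinant, see
`skewFactorialSchur_eq`. -/
noncomputable def skewFactorialSchur {R : Type*} [CommRing R] (n : ℕ) (lam mu : YoungDiagram)
    (a : ℤ → R) : MvPolynomial (Fin n) R :=
  (hMatrix n lam mu a (max (lam.colLen 0) (mu.colLen 0))).det

theorem h_of_neg {R : Type*} [CommRing R] (n : ℕ) (r : ℤ) (a : ℤ → R) (hr : r < 0) :
    h n r a = 0 := if_neg (by omega)

theorem h_zero {R : Type*} [CommRing R] (n : ℕ) (a : ℤ → R) : h n 0 a = 1 := by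
  have hrow : oneRow 0 = ⊥ := by
    ext c
    simp [oneRow, YoungDiagram.mem_ofRowLens]
  have hlen : ∀ i, (⊥ : YoungDiagram).rowLen i = 0 := fun i => by
    simp [YoungDiagram.rowLen_eq_card, YoungDiagram.row]
  have hcol : (⊥ : YoungDiagram).colLen 0 = 0 := by
    simp [YoungDiagram.colLen_eq_card, YoungDiagram.col]
  have h0 : h n 0 a = factorialSchur n ⊥ a := by simp [h, hrow]
  rw [h0]
  refine (existsUnique_quotient n a (delta n)).unique ?_ (mul_one _)
  rw [factorialSchur_spec n ⊥ a (by rw [hcol]; exact Nat.zero_le n)]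
  simp [hlen]

theorem rowLen_eq_zero {lam : YoungDiagram} {m : ℕ} (hm : lam.colLen 0 ≤ m) :
    lam.rowLen m = 0 := by
  by_contra hne
  have h1 : (m, 0) ∈ lam := YoungDiagram.mem_iff_lt_rowLen.mpr (Nat.pos_of_ne_zero hne)
  have h2 := YoungDiagram.mem_iff_lt_colLen.mp h1
  omega

theorem det_hMatrix_succ {R : Type*} [CommRing R] (n : ℕ) (lam mu : YoungDiagram) (a : ℤ → R)
    (m : ℕ) (h1 : lam.colLen 0 ≤ m) (h2 : mu.colLen 0 ≤ m) :
    (hMatrix n lam mu a (m + 1)).det = (hMatrix n lam mu a m).det := by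
  rw [Matrix.det_succ_row _ (Fin.last m), Finset.sum_eq_single (Fin.last m)]
  · have hl : hMatrix n lam mu a (m + 1) (Fin.last m) (Fin.last m) = 1 := by
      simp [hMatrix, rowLen_eq_zero h1, rowLen_eq_zero h2, h_zero]
    have hs : (hMatrix n lam mu a (m + 1)).submatrix (Fin.last m).succAbove
        (Fin.last m).succAbove = hMatrix n lam mu a m := by
      ext1 i j
      simp [hMatrix]
    rw [hl, hs]
    simp [← two_mul]
  · intro j _ hj
    have hjm : (j : ℕ) < m := Fin.val_lt_last hj
    have : hMatrix n lam mu a (m + 1) (Fin.last m) j = 0 := by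
      simp only [hMatrix, Matrix.of_apply, Fin.val_last, rowLen_eq_zero h1]
      apply h_of_neg
      push_cast
      omega
    rw [this]
    simp
  · simp

theorem skewFactorialSchur_eq {R : Type*} [CommRing R] (n : ℕ) (lam mu : YoungDiagram) (a : ℤ → R)
    (m : ℕ) (h1 : lam.colLen 0 ≤ m) (h2 : mu.colLen 0 ≤ m) :
    skewFactorialSchur n lam mu a = (hMatrix n lam mu a m).det := by
  obtain ⟨k, rfl⟩ := Nat.exists_eq_add_of_le (max_le h1 h2)
  clear h1 h2
  induction k with
  | zero => rfl
  | succ k ih =>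
    rw [ih, ← Nat.add_assoc]
    exact (det_hMatrix_succ n lam mu a _ (by omega) (by omega)).symm

end FactorialSchur

namespace FactorialSchur

/-! Let `residue` send f(T) to the coefficient of T^(n-1) in f mod ∏(T - x_i). A quotient of
alternants is a determinant of residues of products g_k f_j, with g_k any monic polynomial of degree
k (`factorialSchur_eq_det_residueMatrix`). For n > 0 this makes h_r(x|a) the residue of
(T|a)^(n-1+r), and a second choice of g_k gives the Jacobi–Trudi formula, which identifies s_λ with
s_{λ/∅}. On the dual side, ∏(T - x_i) = Σ (-1)^j e_j(x|a) (T|a)^(n-j) (`rootPoly_eq_sum_e`).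
Multiplying by a factorial power and taking residues gives Σ (-1)^j e_j(x|τ^(d-1)a) h_{d-j}(x|a) = 0
for d > 0, so suitable triangular matrices of h's and signed e's are inverse to each other. The
determinant defining s_{λ/μ} is a minor of the h-matrix. Jacobi's theorem turns it into the
complementary minor of the e-matrix. Complementing the index set of λ in an m × p box amounts to
conjugating λ, and all signs cancel. -/

theorem shift_shift {A : Type*} (r s : ℤ) (a : ℤ → A) : shift r (shift s a) = shift (r + s) a := by
  funext k
  simp only [shift]
  congr 1
  ring

theorem shift_zero {A : Type*} (a : ℤ → A) : shift 0 a = a := by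
  funext k
  simp [shift]

/-! ### Residues modulo ∏(T - x_i) and quotients of alternants. -/

section Residue

variable {R : Type*} [CommRing R] (n : ℕ)

/-- The factorial power `(T | a)^r` as a polynomial in a new variable `T`. -/
noncomputable def factorialPowerPoly (a : ℤ → R) (r : ℕ) : Polynomial (MvPolynomial (Fin n) R) :=
  ∏ k ∈ Finset.Icc 1 r, (Polynomial.X + Polynomial.C (C (a (k : ℤ))))

theorem eval_factorialPowerPoly (a : ℤ → R) (r : ℕ) (i : Fin n) :
    (factorialPowerPoly n a r).eval (X i) = factorialPower n a i r :=
  (factorialPower_eq_eval n a i r).symm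

theorem monic_factorialPowerPoly (a : ℤ → R) (r : ℕ) : (factorialPowerPoly n a r).Monic :=
  Polynomial.monic_prod_of_monic _ _ fun _ _ => Polynomial.monic_X_add_C _

theorem natDegree_factorialPowerPoly [Nontrivial R] (a : ℤ → R) (r : ℕ) :
    (factorialPowerPoly n a r).natDegree = r := by
  rw [factorialPowerPoly,
    Polynomial.natDegree_prod_of_monic _ _ fun k _ => Polynomial.monic_X_add_C _]
  simp

theorem factorialPowerPoly_zero (a : ℤ → R) : factorialPowerPoly n a 0 = 1 := by
  simp [factorialPowerPoly]

theorem factorialPowerPoly_add (a : ℤ → R) (r s : ℕ) :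
    factorialPowerPoly n a (r + s) =
      factorialPowerPoly n a r * factorialPowerPoly n (shift r a) s := by
  induction s with
  | zero => simp [factorialPowerPoly]
  | succ s ih =>
    have hstep : ∀ (b : ℤ → R) (t : ℕ), factorialPowerPoly n b (t + 1) =
        factorialPowerPoly n b t * (Polynomial.X + Polynomial.C (C (b ((t + 1 : ℕ) : ℤ)))) :=
      fun b t => Finset.prod_Icc_succ_top (by omega) _
    rw [← Nat.add_assoc, hstep, ih, hstep, mul_assoc]
    congr 5
    simp only [shift]
    congr 1
    push_cast
    ring

variable (R) in
/-- The polynomial `∏ (T - x_i)`. -/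
noncomputable def rootPoly : Polynomial (MvPolynomial (Fin n) R) :=
  ∏ i : Fin n, (Polynomial.X - Polynomial.C (X i))

theorem monic_rootPoly : (rootPoly R n).Monic :=
  Polynomial.monic_prod_of_monic _ _ fun _ _ => Polynomial.monic_X_sub_C _

theorem natDegree_rootPoly [Nontrivial R] : (rootPoly R n).natDegree = n := by
  rw [rootPoly, Polynomial.natDegree_prod_of_monic _ _ fun k _ => Polynomial.monic_X_sub_C _]
  simp

theorem eval_rootPoly (i : Fin n) : (rootPoly R n).eval (X i) = 0 := by
  rw [rootPoly, Polynomial.eval_prod]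
  exact Finset.prod_eq_zero (Finset.mem_univ i) (by simp)

variable (R) in
/-- The linear form sending a polynomial `f(T)` to the coefficient of `T^(n-1)` in its remainder
modulo `∏ (T - x_i)`. -/
noncomputable def residue :
    Polynomial (MvPolynomial (Fin n) R) →ₗ[MvPolynomial (Fin n) R] MvPolynomial (Fin n) R :=
  Polynomial.lcoeff _ (n - 1) ∘ₗ Polynomial.modByMonicHom (rootPoly R n)

theorem residue_apply (f : Polynomial (MvPolynomial (Fin n) R)) :
    residue R n f = (f %ₘ rootPoly R n).coeff (n - 1) := rfl

theorem residue_rootPoly_mul (f : Polynomial (MvPolynomial (Fin n) R)) :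
    residue R n (rootPoly R n * f) = 0 := by
  rw [residue_apply,
    (Polynomial.modByMonic_eq_zero_iff_dvd (monic_rootPoly n)).mpr (dvd_mul_right _ _)]
  simp

theorem residue_mul_modByMonic (f g : Polynomial (MvPolynomial (Fin n) R)) :
    residue R n (g * (f %ₘ rootPoly R n)) = residue R n (g * f) := by
  conv_rhs => rw [← Polynomial.modByMonic_add_div f (rootPoly R n)]
  rw [mul_add, map_add, mul_left_comm, residue_rootPoly_mul, add_zero]

theorem residue_of_natDegree_lt [Nontrivial R] {f : Polynomial (MvPolynomial (Fin n) R)}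
    (hf : f.natDegree < n) : residue R n f = f.coeff (n - 1) := by
  rw [residue_apply, (Polynomial.modByMonic_eq_self_iff (monic_rootPoly n)).mpr]
  exact Polynomial.degree_lt_degree (by rwa [natDegree_rootPoly])

theorem residue_of_natDegree_add_one_lt [Nontrivial R]
    {f : Polynomial (MvPolynomial (Fin n) R)} (hf : f.natDegree + 1 < n) : residue R n f = 0 := by
  rw [residue_of_natDegree_lt n (by omega), Polynomial.coeff_eq_zero_of_natDegree_lt (by omega)]

theorem residue_of_natDegree_add_one_eq [Nontrivial R]
    {f : Polynomial (MvPolynomial (Fin n) R)} (hm : f.Monic) (hf : f.natDegree + 1 = n) :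
    residue R n f = 1 := by
  rw [residue_of_natDegree_lt n (by omega), show n - 1 = f.natDegree by omega]
  exact hm

/-- The `n × n` matrix of residues of the products `g_k f_j`. -/
noncomputable def residueMatrix (g f : Fin n → Polynomial (MvPolynomial (Fin n) R)) :
    Matrix (Fin n) (Fin n) (MvPolynomial (Fin n) R) :=
  Matrix.of fun k j => residue R n (g k * f j)

/-- Evaluation at the x_i and the residues of g_k f_j depend only on f_j mod ∏(T - x_i), and
linearly. Both matrices therefore factor through the coefficient matrix of the remainders, whose
determinant is c; u and v do not involve f. -/
theorem exists_det_factorization [Nontrivial R]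
    (g : Fin n → Polynomial (MvPolynomial (Fin n) R)) :
    ∃ u v : MvPolynomial (Fin n) R, ∀ f : Fin n → Polynomial (MvPolynomial (Fin n) R),
      ∃ c, (Matrix.of fun i j => (f j).eval (X i)).det = v * c ∧
        (residueMatrix n g f).det = u * c := by
  refine ⟨(Matrix.of fun k l : Fin n => residue R n (g k * Polynomial.X ^ (l : ℕ))).det,
    (Matrix.of fun i l : Fin n => (X i : MvPolynomial (Fin n) R) ^ (l : ℕ)).det, fun f =>
    ⟨(Matrix.of fun l j : Fin n => (f j %ₘ rootPoly R n).coeff l).det, ?_, ?_⟩⟩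
  all_goals
    rw [← Matrix.det_mul]
    congr 1
    ext1 i j
    have hdeg : (f j %ₘ rootPoly R n).natDegree < n := by
      -- An index in `Fin n` forces n > 0, so the modulus is not 1 and the strict degree bound
      -- holds.
      have hn : 0 < n := i.pos
      have := Polynomial.natDegree_modByMonic_lt (f j) (monic_rootPoly (R := R) n) (by
        intro h
        have := natDegree_rootPoly (R := R) n
        rw [h, Polynomial.natDegree_one] at this
        omega)
      rwa [natDegree_rootPoly] at this
    simp only [residueMatrix, Matrix.of_apply, Matrix.mul_apply]
  · have : (f j).eval (X i) = (f j %ₘ rootPoly R n).eval (X i) := by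
      conv_lhs => rw [← Polynomial.modByMonic_add_div (f j) (rootPoly R n)]
      simp [eval_rootPoly]
    rw [this, Polynomial.eval_eq_sum_range' hdeg, ← Fin.sum_univ_eq_sum_range
      (fun l => (f j %ₘ rootPoly R n).coeff l * (X i : MvPolynomial (Fin n) R) ^ l)]
    exact Finset.sum_congr rfl fun l _ => mul_comm _ _
  · rw [← residue_mul_modByMonic]
    conv_lhs => rw [Polynomial.as_sum_range' _ n hdeg]
    rw [Finset.mul_sum, map_sum, ← Fin.sum_univ_eq_sum_range (fun l => residue R n
      (g i * Polynomial.monomial l ((f j %ₘ rootPoly R n).coeff l)))]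
    refine Finset.sum_congr rfl fun l _ => ?_
    rw [← Polynomial.C_mul_X_pow_eq_monomial, mul_left_comm, ← Polynomial.smul_eq_C_mul, map_smul,
      smul_eq_mul, mul_comm]

/-- For α = δ the products have degree k + (n-1-j), so the residue matrix is unitriangular. This
fixes the constant relating the two determinants of the factorization. The freedom in g is exploited
later by two different choices. -/
theorem alternant_eq_mul_det_residueMatrix [Nontrivial R] (a : ℤ → R) (α : Fin n → ℕ)
    (g : Fin n → Polynomial (MvPolynomial (Fin n) R)) (hg : ∀ k, (g k).Monic)
    (hdeg : ∀ k, (g k).natDegree = k) :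
    alternant n a α = alternant n a (delta n) *
      (residueMatrix n g fun j => factorialPowerPoly n a (α j)).det := by
  obtain ⟨u, v, H⟩ := exists_det_factorization n g
  have hdet : ∀ β : Fin n → ℕ, alternant n a β =
      (Matrix.of fun i j : Fin n => (factorialPowerPoly n a (β j)).eval (X i)).det := fun β => by
    simp only [eval_factorialPowerPoly]
    rfl
  have hδ : (residueMatrix n g fun j => factorialPowerPoly n a (delta n j)).det = 1 := by
    have hd : ∀ k j : Fin n, (g k * factorialPowerPoly n a (delta n j)).natDegree =
        k + (n - 1 - j) := fun k j => by
      rw [(hg k).natDegree_mul (monic_factorialPowerPoly n a _), hdeg,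
        natDegree_factorialPowerPoly, delta]
    rw [Matrix.det_of_isLowerTriangular]
    · refine Finset.prod_eq_one fun k _ => ?_
      refine residue_of_natDegree_add_one_eq n ((hg k).mul (monic_factorialPowerPoly n a _)) ?_
      rw [hd]
      omega
    · intro k j hkj
      have hkj : k < j := hkj
      refine residue_of_natDegree_add_one_lt n ?_
      rw [hd]
      omega
  obtain ⟨c, hc1, hc2⟩ := H fun j => factorialPowerPoly n a (α j)
  obtain ⟨d, hd1, hd2⟩ := H fun j => factorialPowerPoly n a (delta n j)
  rw [hdet, hdet (delta n), hc1, hd1, hc2]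
  rw [hδ] at hd2
  linear_combination (v * c) * hd2

theorem isRegular_alternant_delta (a : ℤ → R) : IsRegular (alternant n a (delta n)) := by
  obtain ⟨u, hu⟩ := alternant_delta n a
  rw [← hu]
  refine IsRegular.mul ?_ u.isRegular
  refine IsRegular.prod fun i _ => IsRegular.prod fun j hj => ?_
  exact isRegular_X_sub_X (Finset.mem_Ioi.mp hj).ne'

theorem factorialSchur_eq_det_residueMatrix [Nontrivial R] (a : ℤ → R) (lam : YoungDiagram)
    (hlam : lam.colLen 0 ≤ n) (g : Fin n → Polynomial (MvPolynomial (Fin n) R))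
    (hg : ∀ k, (g k).Monic) (hdeg : ∀ k, (g k).natDegree = k) :
    factorialSchur n lam a =
      (residueMatrix n g fun j => factorialPowerPoly n a (lam.rowLen j + delta n j)).det :=
  (isRegular_alternant_delta n a).left <| (factorialSchur_spec n lam a hlam).trans
    (alternant_eq_mul_det_residueMatrix n a _ g hg hdeg)

end Residue

/-! ### Row and column lengths of one-row, one-column and empty diagrams. -/

theorem mem_oneRow {r i j : ℕ} : (i, j) ∈ oneRow r ↔ i = 0 ∧ j < r := by
  simp only [oneRow, YoungDiagram.mem_ofRowLens, List.length_singleton]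
  constructor
  · rintro ⟨h1, h2⟩
    have hi : i = 0 := by omega
    subst hi
    exact ⟨rfl, h2⟩
  · rintro ⟨rfl, h⟩
    exact ⟨by simp, h⟩

theorem rowLen_oneRow (r i : ℕ) : (oneRow r).rowLen i = if i = 0 then r else 0 := by
  refine eq_of_forall_lt_iff fun j => ?_
  rw [← YoungDiagram.mem_iff_lt_rowLen, mem_oneRow]
  split_ifs <;> simp_all

theorem colLen_oneRow (r j : ℕ) : (oneRow r).colLen j = if j < r then 1 else 0 := by
  refine eq_of_forall_lt_iff fun i => ?_
  rw [← YoungDiagram.mem_iff_lt_colLen, mem_oneRow]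
  split_ifs <;> simp_all

theorem rowLen_oneColumn (r i : ℕ) : (oneColumn r).rowLen i = if i < r then 1 else 0 := by
  rw [oneColumn, YoungDiagram.rowLen_transpose, colLen_oneRow]

theorem colLen_oneColumn (r j : ℕ) : (oneColumn r).colLen j = if j = 0 then r else 0 := by
  rw [oneColumn, YoungDiagram.colLen_transpose, rowLen_oneRow]

theorem rowLen_bot (i : ℕ) : (⊥ : YoungDiagram).rowLen i = 0 := by
  simp [YoungDiagram.rowLen_eq_card, YoungDiagram.row]

theorem colLen_bot (j : ℕ) : (⊥ : YoungDiagram).colLen j = 0 := by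
  simp [YoungDiagram.colLen_eq_card, YoungDiagram.col]

variable {R : Type*} [CommRing R] (n : ℕ)

/-! ### The h_r as residues, and the Jacobi–Trudi formula. -/

theorem h_natCast [Nontrivial R] (hn : 0 < n) (r : ℕ) (a : ℤ → R) :
    h n r a = residue R n (factorialPowerPoly n a (n - 1 + r)) := by
  obtain ⟨n, rfl⟩ := Nat.exists_eq_succ_of_ne_zero hn.ne'
  rw [h, if_pos (by omega), Int.toNat_natCast, factorialSchur_eq_det_residueMatrix (n + 1) a _
    (by rw [colLen_oneRow]; split_ifs <;> omega) (fun k => factorialPowerPoly (n + 1) a k)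
    (fun k => monic_factorialPowerPoly _ _ _) (fun k => natDegree_factorialPowerPoly _ _ _)]
  have hd : ∀ k l : ℕ, (factorialPowerPoly (n + 1) a k * factorialPowerPoly (n + 1) a l).natDegree
      = k + l := fun k l => by
    rw [(monic_factorialPowerPoly _ a _).natDegree_mul (monic_factorialPowerPoly _ a _),
      natDegree_factorialPowerPoly, natDegree_factorialPowerPoly]
  -- Past the first column the exponents are those of δ, so the matrix is lower triangular with ones
  -- on the rest of the diagonal, and only the corner entry survives.
  rw [Matrix.det_of_isLowerTriangular, Fin.prod_univ_succ, Finset.prod_eq_one, mul_one]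
  · simp [residueMatrix, rowLen_oneRow, delta, factorialPowerPoly_zero, add_comm]
  · intro k _
    refine residue_of_natDegree_add_one_eq _
      ((monic_factorialPowerPoly _ a _).mul (monic_factorialPowerPoly _ a _)) ?_
    have := k.isLt
    rw [hd, rowLen_oneRow, delta, if_neg (Fin.val_ne_zero_iff.mpr (Fin.succ_ne_zero k)),
      Fin.val_succ]
    omega
  · intro k j hkj
    have hkj : k < j := hkj
    refine residue_of_natDegree_add_one_lt _ ?_
    rw [hd, rowLen_oneRow, delta, if_neg (by omega)]
    omega

/-- Negative r is covered too: the degree is then below n - 1 and the residue vanishes. The case n =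
0 must be excluded, since there the residue is identically 0 while h_0 = 1. -/
theorem h_eq_residue [Nontrivial R] (hn : 0 < n) (r : ℤ) (d : ℕ) (hd : (d : ℤ) = n - 1 + r)
    (a : ℤ → R) : h n r a = residue R n (factorialPowerPoly n a d) := by
  rcases lt_or_ge r 0 with hr | hr
  · rw [h_of_neg n r a hr, residue_of_natDegree_add_one_lt]
    rw [natDegree_factorialPowerPoly]
    omega
  · lift r to ℕ using hr
    rw [h_natCast n hn, show n - 1 + r = d by omega]

/-- The Jacobi–Trudi identity for factorial Schur polynomials. -/
theorem factorialSchur_eq_det_hMatrix [Nontrivial R] (a : ℤ → R) (lam : YoungDiagram)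
    (hlam : lam.colLen 0 ≤ n) : factorialSchur n lam a = (hMatrix n lam ⊥ a n).det := by
  -- With g_k = (T | τ^(-k)a)^k the product g_k (T|a)^d is the single factorial power (T |
  -- τ^(-k)a)^(k+d), so every entry is one h.
  rw [factorialSchur_eq_det_residueMatrix n a lam hlam
    (fun k => factorialPowerPoly n (shift (-(k : ℤ)) a) k)
    (fun k => monic_factorialPowerPoly _ _ _) (fun k => natDegree_factorialPowerPoly _ _ _),
    ← Matrix.det_transpose]
  congr 1
  ext1 i k
  rw [Matrix.transpose_apply, residueMatrix, Matrix.of_apply, hMatrix, Matrix.of_apply, rowLen_bot]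
  have hs : factorialPowerPoly n a (lam.rowLen i + delta n i) =
      factorialPowerPoly n (shift (k : ℕ) (shift (-(k : ℕ) : ℤ) a)) (lam.rowLen i + delta n i) := by
    rw [shift_shift, add_neg_cancel, shift_zero]
  rw [hs, ← factorialPowerPoly_add, h_eq_residue n i.pos _ (k + (lam.rowLen i + delta n i))]
  · congr 3
    push_cast
    ring
  · have := i.isLt
    rw [delta]
    omega

theorem skewFactorialSchur_bot [Nontrivial R] (a : ℤ → R) (lam : YoungDiagram)
    (hlam : lam.colLen 0 ≤ n) : factorialSchur n lam a = skewFactorialSchur n lam ⊥ a := by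
  rw [factorialSchur_eq_det_hMatrix n a lam hlam,
    skewFactorialSchur_eq n lam ⊥ a n hlam (by rw [colLen_bot]; omega)]

/-! ### Expansion of ∏(T - x_i) in factorial powers, with coefficients ±e_j. -/

theorem exists_eq_sum_factorialPowerPoly [Nontrivial R] (a : ℤ → R) (d : ℕ) :
    ∀ q : Polynomial (MvPolynomial (Fin n) R), q.degree < d →
      ∃ b : ℕ → MvPolynomial (Fin n) R,
        q = ∑ k ∈ Finset.range d, b k • factorialPowerPoly n a k := by
  induction d with
  | zero =>
    intro q hq
    exact ⟨0, by simpa using hq⟩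
  | succ d ih =>
    intro q hq
    have hp := natDegree_factorialPowerPoly n a d
    have hm := monic_factorialPowerPoly n a d
    obtain ⟨b, hb⟩ := ih (q - q.coeff d • factorialPowerPoly n a d) (by
      rw [Polynomial.degree_lt_iff_coeff_zero] at hq ⊢
      intro k hk
      rw [Polynomial.coeff_sub, Polynomial.coeff_smul, smul_eq_mul]
      rcases hk.eq_or_lt with rfl | hk
      · rw [show (factorialPowerPoly n a d).coeff d = 1 by rw [← hm.coeff_natDegree, hp], mul_one,
          sub_self]
      · rw [hq k hk, Polynomial.coeff_eq_zero_of_natDegree_lt (hp.trans_lt hk), mul_zero, sub_zero])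
    refine ⟨Function.update b d (q.coeff d), ?_⟩
    rw [Finset.sum_range_succ, Function.update_self, ← sub_eq_iff_eq_add, hb]
    refine Finset.sum_congr rfl fun k hk => ?_
    rw [Function.update_of_ne (Finset.mem_range.mp hk).ne]

theorem exists_rootPoly_eq_sum [Nontrivial R] (a : ℤ → R) :
    ∃ b : Fin (n + 1) → MvPolynomial (Fin n) R, b 0 = 1 ∧
      rootPoly R n = ∑ j : Fin (n + 1), b j • factorialPowerPoly n a (n - j) := by
  obtain ⟨b, hb⟩ := exists_eq_sum_factorialPowerPoly n a n
    (rootPoly R n - factorialPowerPoly n a n) (by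
      have h1 := (monic_rootPoly (R := R) n)
      have h2 := monic_factorialPowerPoly n a n
      have h3 := natDegree_rootPoly (R := R) n
      have h4 := natDegree_factorialPowerPoly n a n
      have := Polynomial.degree_sub_lt_left (p := rootPoly R n) (q := factorialPowerPoly n a n)
        (by rw [Polynomial.degree_eq_natDegree h1.ne_zero, Polynomial.degree_eq_natDegree h2.ne_zero,
          h3, h4]) h1.ne_zero (by rw [h1.leadingCoeff, h2.leadingCoeff])
      rwa [Polynomial.degree_eq_natDegree h1.ne_zero, h3] at this)
  refine ⟨Fin.cons 1 fun j => b (n - 1 - j), rfl, ?_⟩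
  rw [Fin.sum_univ_succ, ← sub_eq_iff_eq_add', Fin.cons_zero, one_smul, Fin.val_zero, Nat.sub_zero, hb,
    ← Finset.sum_range_reflect, ← Fin.sum_univ_eq_sum_range
      (fun j => b (n - 1 - j) • factorialPowerPoly n a (n - 1 - j))]
  refine Finset.sum_congr rfl fun j _ => ?_
  rw [Fin.cons_succ, Fin.val_succ, show n - (j + 1 : ℕ) = n - 1 - j by omega]

theorem e_natCast {r : ℕ} (hr : r ≤ n) (a : ℤ → R) :
    e n r a = factorialSchur n (oneColumn r) a := by
  rw [e, if_pos (by omega), Int.toNat_natCast]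

theorem e_of_neg (r : ℤ) (a : ℤ → R) (hr : r < 0) : e n r a = 0 := if_neg (by omega)

theorem e_of_lt (r : ℤ) (a : ℤ → R) (hr : (n : ℤ) < r) : e n r a = 0 := if_neg (by omega)

theorem alternant_delta_mul_e {r : ℕ} (hr : r ≤ n) (a : ℤ → R) :
    alternant n a (delta n) * e n r a =
      alternant n a fun j => (if (j : ℕ) < r then 1 else 0) + delta n j := by
  rw [e_natCast n hr, factorialSchur_spec n _ a (by simpa [colLen_oneColumn] using hr)]
  simp only [rowLen_oneColumn]

theorem e_zero (a : ℤ → R) : e n 0 a = 1 :=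
  (isRegular_alternant_delta n a).left <| by
    have := alternant_delta_mul_e n (Nat.zero_le n) a
    simpa using this

/-- The matrix with rows `((T | a)^{n-j})_j` and `((x_i | a)^{n-j})_j`. -/
noncomputable def borderedMatrix (a : ℤ → R) :
    Matrix (Fin (n + 1)) (Fin (n + 1)) (Polynomial (MvPolynomial (Fin n) R)) :=
  Matrix.of fun i j => (Fin.cons (factorialPowerPoly n a (n - j))
    (fun i' : Fin n => Polynomial.C (factorialPower n a i' (n - j))) :
      Fin (n + 1) → Polynomial (MvPolynomial (Fin n) R)) i

theorem det_map_C_factorialPower (a : ℤ → R) (α : Fin n → ℕ)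
    (M : Matrix (Fin n) (Fin n) (Polynomial (MvPolynomial (Fin n) R)))
    (hM : ∀ i j, M i j = Polynomial.C (factorialPower n a i (α j))) :
    M.det = Polynomial.C (alternant n a α) := by
  rw [alternant, RingHom.map_det]
  congr 1
  ext1 i j
  exact hM i j

/-- Expand along the first row. Deleting column j from the exponents n, n-1, …, 0 leaves (1^j) + δ,
so the minor is A_δ e_j. -/
theorem det_borderedMatrix_eq_sum (a : ℤ → R) :
    (borderedMatrix n a).det = Polynomial.C (alternant n a (delta n)) *
      ∑ j : Fin (n + 1), ((-1) ^ (j : ℕ) * e n (j : ℕ) a) • factorialPowerPoly n a (n - j) := by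
  rw [Matrix.det_succ_row_zero, Finset.mul_sum]
  refine Finset.sum_congr rfl fun j _ => ?_
  rw [det_map_C_factorialPower n a (fun k => (if (k : ℕ) < j then 1 else 0) + delta n k),
    ← alternant_delta_mul_e n (by omega), Polynomial.smul_eq_C_mul]
  · simp only [borderedMatrix, Matrix.of_apply, Fin.cons_zero, map_mul, map_pow, map_neg, map_one]
    ring
  · intro i k
    simp only [borderedMatrix, Matrix.submatrix_apply, Matrix.of_apply, Fin.cons_succ]
    congr 2
    have := k.isLt
    simp only [Fin.succAbove, Fin.lt_def, delta, Fin.val_castSucc]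
    split_ifs <;> simp <;> omega

/-- Replace the first column by the combination of columns that expands ∏(T - x_i). Its own
coefficient is 1, so the determinant is unchanged; below the top entry the new column holds values
at the roots x_i, hence zeros. -/
theorem det_borderedMatrix_eq_mul_rootPoly [Nontrivial R] (a : ℤ → R) :
    (borderedMatrix n a).det = Polynomial.C (alternant n a (delta n)) * rootPoly R n := by
  obtain ⟨b, hb0, hb⟩ := exists_rootPoly_eq_sum n a
  have hcol := Matrix.det_updateCol_sum (borderedMatrix n a) 0 fun j => Polynomial.C (b j)
  rw [hb0, map_one, one_smul] at hcol
  have htop : ∑ j, Polynomial.C (b j) • borderedMatrix n a 0 j = rootPoly R n := by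
    rw [hb]
    refine Finset.sum_congr rfl fun j _ => ?_
    simp [borderedMatrix, Polynomial.smul_eq_C_mul]
  have hrest : ∀ i : Fin n, ∑ j, Polynomial.C (b j) • borderedMatrix n a i.succ j = 0 := fun i => by
    have := congrArg Polynomial.C (eval_rootPoly (R := R) n i)
    rw [hb, Polynomial.eval_finsetSum, map_sum, map_zero] at this
    rw [← this]
    refine Finset.sum_congr rfl fun j _ => ?_
    simp [borderedMatrix, eval_factorialPowerPoly]
  rw [← hcol, Matrix.det_succ_column_zero, Fin.sum_univ_succ, Finset.sum_eq_zero, add_zero,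
    det_map_C_factorialPower n a (delta n)]
  · simp only [Matrix.updateCol_self, htop]
    simp [mul_comm]
  · intro i k
    simp only [borderedMatrix, Matrix.submatrix_apply, Fin.zero_succAbove,
      Matrix.updateCol_ne (Fin.succ_ne_zero k), Matrix.of_apply, Fin.cons_succ, delta, Fin.val_succ]
    rw [show n - (k + 1 : ℕ) = n - 1 - k by omega]
  · intro i _
    simp only [Matrix.updateCol_self, hrest]
    simp

theorem rootPoly_eq_sum_e [Nontrivial R] (a : ℤ → R) :
    rootPoly R n =
      ∑ j : Fin (n + 1), ((-1) ^ (j : ℕ) * e n (j : ℕ) a) • factorialPowerPoly n a (n - j) := by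
  have := (det_borderedMatrix_eq_mul_rootPoly n a).symm.trans (det_borderedMatrix_eq_sum n a)
  ext1 k
  refine (isRegular_alternant_delta n a).left ?_
  simpa only [Polynomial.coeff_C_mul] using congrArg (fun q => Polynomial.coeff q k) this

/-! ### Orthogonality of the e's and the h's. -/

/-- Expand ∏(T - x_i) along τ^(d-1)a and multiply by (T|a)^(d-1): the factorial powers merge into
(T|a)^(d-1+n-j), whose residue is h_{d-j}, while the whole product has residue 0. -/
theorem sum_e_mul_h_of_pos [Nontrivial R] (hn : 0 < n) {d : ℕ} (hd : 0 < d) (a : ℤ → R) :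
    ∑ j ∈ Finset.range (n + 1), (-1) ^ j * e n j (shift (d - 1) a) * h n ((d : ℤ) - j) a = 0 := by
  have key := residue_rootPoly_mul n (factorialPowerPoly n a (d - 1))
  rw [rootPoly_eq_sum_e n (shift ((d : ℤ) - 1) a), Finset.sum_mul, map_sum] at key
  rw [← key, ← Fin.sum_univ_eq_sum_range
    (fun j : ℕ => (-1) ^ j * e n j (shift (d - 1) a) * h n ((d : ℤ) - j) a)]
  refine Finset.sum_congr rfl fun j _ => ?_
  have := j.isLt
  rw [smul_mul_assoc, map_smul, smul_eq_mul, mul_comm (factorialPowerPoly _ _ _),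
    h_eq_residue n hn _ ((d - 1) + (n - j)) (by omega), factorialPowerPoly_add,
    Nat.cast_pred hd]

theorem h_zero_vars {r : ℤ} (hr : r ≠ 0) (a : ℤ → R) : h 0 r a = 0 := by
  rw [h]
  split_ifs with h0
  · rw [factorialSchur, if_neg]
    rw [colLen_oneRow, if_pos (by omega)]
    omega
  · rfl

theorem sum_e_mul_h [Nontrivial R] {d : ℕ} (hd : 0 < d) (a : ℤ → R) :
    ∑ j ∈ Finset.range (d + 1), (-1) ^ j * e n j (shift (d - 1) a) * h n ((d : ℤ) - j) a = 0 := by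
  have hsum : ∑ j ∈ Finset.range (n + 1),
      (-1) ^ j * e n j (shift (d - 1) a) * h n ((d : ℤ) - j) a = 0 := by
    rcases n.eq_zero_or_pos with rfl | hn
    · simp [h_zero_vars (r := d) (by omega)]
    · exact sum_e_mul_h_of_pos n hn hd a
  rw [← hsum]
  -- Both ranges extend to n + d: beyond d the h's vanish, beyond n the e's do.
  have hsub : ∀ N ≤ n + d, (∀ j : ℕ, N < j →
      (-1) ^ j * e n j (shift (d - 1) a) * h n ((d : ℤ) - j) a = 0) →
      ∑ j ∈ Finset.range (N + 1), (-1) ^ j * e n j (shift (d - 1) a) * h n ((d : ℤ) - j) a =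
      ∑ j ∈ Finset.range (n + d + 1),
        (-1) ^ j * e n j (shift (d - 1) a) * h n ((d : ℤ) - j) a := by
    intro N hN H
    refine Finset.sum_subset (Finset.range_mono (by omega)) fun j _ hj => H j ?_
    simpa [Nat.lt_succ_iff] using hj
  rw [hsub d (by omega) fun j hj => by rw [h_of_neg _ _ _ (by omega), mul_zero],
    hsub n (by omega) fun j hj => by rw [e_of_lt _ _ _ (by omega), mul_zero, zero_mul]]

/-! ### Mutually inverse triangular matrices. -/

/-- The truncation to `-m ≤ α, β < N - m` of the matrix `(h_{α-β}(x | τ^{β+1} a))`. -/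
noncomputable def hTruncation (a : ℤ → R) (m N : ℕ) :
    Matrix (Fin N) (Fin N) (MvPolynomial (Fin n) R) :=
  Matrix.of fun i j => h n ((i : ℤ) - j) (shift ((j : ℤ) - m + 1) a)

/-- The truncation to `-m ≤ α, β < N - m` of the matrix `((-1)^{α-β} e_{α-β}(x | τ^α a))`. -/
noncomputable def eTruncation (a : ℤ → R) (m N : ℕ) :
    Matrix (Fin N) (Fin N) (MvPolynomial (Fin n) R) :=
  Matrix.of fun i j => (-1) ^ ((i : ℕ) + j) * e n ((i : ℤ) - j) (shift ((i : ℤ) - m) a)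

theorem eTruncation_mul_hTruncation [Nontrivial R] (a : ℤ → R) (m N : ℕ) :
    eTruncation n a m N * hTruncation n a m N = 1 := by
  ext1 i j
  have hzero : ∀ k : Fin N, ¬ (j ≤ k ∧ k ≤ i) →
      eTruncation n a m N i k * hTruncation n a m N k j = 0 := by
    intro k hk
    rcases lt_or_ge k j with hkj | hkj
    · have hkj : (k : ℕ) < j := hkj
      rw [hTruncation, Matrix.of_apply, h_of_neg _ _ _ (by omega), mul_zero]
    · have hik : (i : ℕ) < k := not_le.mp fun h => hk ⟨hkj, h⟩
      rw [eTruncation, Matrix.of_apply, e_of_neg _ _ _ (by omega), mul_zero, zero_mul]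
  rw [Matrix.mul_apply]
  rcases lt_trichotomy i j with hij | rfl | hij
  · rw [Matrix.one_apply_ne hij.ne]
    exact Finset.sum_eq_zero fun k _ => hzero k fun h => absurd (h.1.trans h.2) hij.not_ge
  · rw [Matrix.one_apply_eq, Finset.sum_eq_single i]
    · simp [eTruncation, hTruncation, e_zero, h_zero, ← two_mul]
    · exact fun k _ hk => hzero k fun h => hk (le_antisymm h.2 h.1)
    · simp
  · rw [Matrix.one_apply_ne hij.ne']
    have hij' : (j : ℕ) < i := hij
    -- With d = i - j, the shift by d - 1 takes τ^(j-m+1)a to τ^(i-m)a, the sequence in row i of the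
    -- e-matrix; the summation index is r = i - k.
    have key := sum_e_mul_h n (d := i - j) (by omega) (shift ((j : ℤ) - m + 1) a)
    rw [← key]
    symm
    refine Finset.sum_of_injOn (fun r => ⟨i - r, by omega⟩) ?_ (by simp) ?_ ?_
    · intro r hr s hs hrs
      simp only [Finset.coe_range, Set.mem_Iio, Fin.mk.injEq] at hr hs hrs
      omega
    · intro k _ hk
      refine hzero k fun h => hk ⟨i - k, ?_, ?_⟩
      · have h1 : (j : ℕ) ≤ k := h.1
        simp only [Finset.coe_range, Set.mem_Iio]
        omega
      · have h1 : (k : ℕ) ≤ i := h.2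
        ext
        simp only
        omega
    · intro r hr
      have hr : r < i - j + 1 := Finset.mem_range.mp hr
      simp only [eTruncation, hTruncation, Matrix.of_apply, shift_shift]
      congr 1
      · congr 1
        · rw [show (i : ℕ) + (i - r) = r + 2 * (i - r) by omega, pow_add, pow_mul]
          simp
        · congr 2 <;> omega
      · congr 1
        omega

theorem det_hTruncation (a : ℤ → R) (m N : ℕ) : (hTruncation n a m N).det = 1 := by
  rw [Matrix.det_of_isLowerTriangular]
  · refine Finset.prod_eq_one fun i _ => ?_
    simp [hTruncation, h_zero]
  · intro i j hij
    have hij : (i : ℕ) < j := hij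
    rw [hTruncation, Matrix.of_apply, h_of_neg _ _ _ (by omega)]

end FactorialSchur

/-! ### Complementary minors. -/

/-- Jacobi's identity for complementary minors of mutually inverse matrices. -/
theorem Matrix.det_submatrix_eq_of_mul_eq_one {S ι κ ν : Type*} [CommRing S] [Fintype ι]
    [DecidableEq ι] [Fintype κ] [DecidableEq κ] [Fintype ν] [DecidableEq ν] {A B : Matrix ν ν S}
    (hAB : A * B = 1) (r c : ι ⊕ κ ≃ ν) :
    (A.submatrix (r ∘ Sum.inl) (c ∘ Sum.inl)).det =
      (A.submatrix r c).det * (B.submatrix (c ∘ Sum.inr) (r ∘ Sum.inr)).det := by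
  have hmul : A.submatrix r c * B.submatrix c r = 1 := by
    rw [Matrix.submatrix_mul_equiv, hAB, Matrix.submatrix_one_equiv]
  -- The right factor is the identity with its second block column replaced by that of the inverse,
  -- so the product keeps the first block column of A and has the second of the identity.
  -- Determinants of both sides give the claim.
  have hcol : A.submatrix r c *
      Matrix.fromBlocks 1 (B.submatrix (c ∘ Sum.inl) (r ∘ Sum.inr)) 0
        (B.submatrix (c ∘ Sum.inr) (r ∘ Sum.inr)) =
      Matrix.fromBlocks (A.submatrix (r ∘ Sum.inl) (c ∘ Sum.inl)) 0
        (A.submatrix (r ∘ Sum.inr) (c ∘ Sum.inl)) 1 := by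
    ext1 i j
    rcases j with j | j
    · rcases i with i | i <;> simp [Matrix.mul_apply, Fintype.sum_sum_type, Matrix.one_apply]
    · have := congrFun (congrFun hmul i) (Sum.inr j)
      rw [Matrix.mul_apply, Fintype.sum_sum_type] at this
      rw [Matrix.mul_apply, Fintype.sum_sum_type]
      rcases i with i | i <;> simpa [Matrix.one_apply] using this
  have := congrArg Matrix.det hcol
  rw [Matrix.det_mul, Matrix.det_fromBlocks_zero₂₁, Matrix.det_fromBlocks_zero₁₂, Matrix.det_one,
    Matrix.det_one, one_mul, mul_one] at this
  exact this.symm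

/-! ### Complementary positions of a partition and its conjugate. -/

namespace YoungDiagram

variable {m p : ℕ} (lam : YoungDiagram)

theorem rowLen_le {lam : YoungDiagram} (hp : lam.rowLen 0 ≤ p) (i : ℕ) : lam.rowLen i ≤ p :=
  (lam.rowLen_anti 0 i (Nat.zero_le i)).trans hp

theorem colLen_le {lam : YoungDiagram} (hm : lam.colLen 0 ≤ m) (j : ℕ) : lam.colLen j ≤ m :=
  (lam.colLen_anti 0 j (Nat.zero_le j)).trans hm

theorem lt_rowLen_iff_lt_colLen {i j : ℕ} : j < lam.rowLen i ↔ i < lam.colLen j := by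
  rw [← mem_iff_lt_rowLen, ← mem_iff_lt_colLen]

/-- The positions `λ_i - i + m` (`1 ≤ i ≤ m`) and `j - 1 - λ'_j + m` (`1 ≤ j ≤ p`), which together
exhaust `0, …, m + p - 1` when `λ` fits in the rectangle with `m` rows and `p` columns. -/
def position (hm : lam.colLen 0 ≤ m) (hp : lam.rowLen 0 ≤ p) : Fin m ⊕ Fin p → Fin (m + p) :=
  Sum.elim (fun i => ⟨lam.rowLen i + (m - 1 - i), by have := rowLen_le hp i; omega⟩)
    (fun j => ⟨m + j - lam.colLen j, by omega⟩)

variable {lam} (hm : lam.colLen 0 ≤ m) (hp : lam.rowLen 0 ≤ p)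

theorem position_inl_lt_inl {i j : Fin m} (hij : i < j) :
    lam.position hm hp (Sum.inl j) < lam.position hm hp (Sum.inl i) := by
  have := lam.rowLen_anti i j hij.le
  have : (i : ℕ) < j := hij
  simp only [position, Sum.elim_inl, Fin.mk_lt_mk]
  omega

theorem position_inr_lt_inr {i j : Fin p} (hij : i < j) :
    lam.position hm hp (Sum.inr i) < lam.position hm hp (Sum.inr j) := by
  have := lam.colLen_anti i j hij.le
  have := colLen_le hm i
  have : (i : ℕ) < j := hij
  simp only [position, Sum.elim_inr, Fin.mk_lt_mk]
  omega

/-- Row i and column j are inverted exactly when (i, j) is a cell of the diagram; this is what makes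
the sign computable. -/
theorem position_inl_lt_inr_iff {i : Fin m} {j : Fin p} :
    lam.position hm hp (Sum.inl i) < lam.position hm hp (Sum.inr j) ↔ ¬ (i : ℕ) < lam.colLen j := by
  have := lam.lt_rowLen_iff_lt_colLen (i := i) (j := j)
  have := colLen_le hm j
  simp only [position, Sum.elim_inl, Sum.elim_inr, Fin.mk_lt_mk]
  omega

theorem position_inl_ne_inr (i : Fin m) (j : Fin p) :
    lam.position hm hp (Sum.inl i) ≠ lam.position hm hp (Sum.inr j) := by
  have := lam.lt_rowLen_iff_lt_colLen (i := i) (j := j)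
  have := colLen_le hm j
  simp only [position, Sum.elim_inl, Sum.elim_inr, ne_eq, Fin.mk.injEq]
  omega

theorem position_bijective : Function.Bijective (lam.position hm hp) := by
  rw [Fintype.bijective_iff_injective_and_card]
  refine ⟨?_, by simp⟩
  rintro (i | i) (j | j) hij
  · rcases lt_trichotomy i j with h | h | h
    · exact absurd hij (position_inl_lt_inl hm hp h).ne'
    · rw [h]
    · exact absurd hij (position_inl_lt_inl hm hp h).ne
  · exact absurd hij (position_inl_ne_inr hm hp i j)
  · exact absurd hij (position_inl_ne_inr hm hp j i).symm
  · rcases lt_trichotomy i j with h | h | h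
    · exact absurd hij (position_inr_lt_inr hm hp h).ne
    · rw [h]
    · exact absurd hij (position_inr_lt_inr hm hp h).ne'

/-- The bijection given by `YoungDiagram.position`. -/
noncomputable def positionEquiv : Fin m ⊕ Fin p ≃ Fin (m + p) :=
  Equiv.ofBijective _ (position_bijective hm hp)

/-- Count inversions: row positions decrease, so all their pairs are inverted; column positions
increase, so none are; mixed inversions are the cells, λ'_j of them in column j. The first factor
depends on m alone and is left unevaluated because it will be squared. -/
theorem sign_positionEquiv :
    Equiv.Perm.sign (finSumFinEquiv.symm.trans (positionEquiv hm hp)) =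
      (∏ i : Fin m, ∏ _j ∈ Finset.Ioi i, (-1 : ℤˣ)) * ∏ j : Fin p, (-1) ^ lam.colLen j := by
  have hfil : ∀ (N : ℕ) (i : Fin N) (f : Fin N → ℤˣ),
      ∏ j ∈ Finset.Ioi i, f j = ∏ j, if i < j then f j else 1 := fun N i f => by
    rw [← Finset.prod_filter]
    congr 1
    ext j
    simp
  have hcast : ∀ i j : Fin m, Fin.castAdd p i < Fin.castAdd p j ↔ i < j := fun _ _ => Iff.rfl
  simp only [Equiv.Perm.sign_eq_prod_prod_Ioi, hfil, Fin.prod_univ_add, Equiv.trans_apply,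
    finSumFinEquiv_symm_apply_castAdd, finSumFinEquiv_symm_apply_natAdd, positionEquiv,
    Equiv.ofBijective_apply, hcast, Fin.natAdd_lt_natAdd_iff]
  rw [Finset.prod_mul_distrib, Finset.prod_eq_one (s := Finset.univ) (f := fun i : Fin p => _ * _),
    mul_one]
  · congr 1
    · refine Finset.prod_congr rfl fun i _ => Finset.prod_congr rfl fun j _ => ?_
      split_ifs with h1 h2
      · exact absurd h2 (position_inl_lt_inl hm hp h1).not_gt
      · rfl
      · rfl
    · rw [Finset.prod_comm]
      refine Finset.prod_congr rfl fun j _ => ?_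
      have hle := colLen_le hm j
      have hlt : ∀ i : Fin m, Fin.castAdd p i < Fin.natAdd m j := fun i => by
        rw [Fin.lt_def, Fin.val_castAdd, Fin.val_natAdd]
        omega
      simp only [hlt, if_true, position_inl_lt_inr_iff, ite_not]
      rw [Fin.prod_univ_eq_prod_range (fun i => if i < lam.colLen j then (-1 : ℤˣ) else 1),
        Finset.prod_ite, Finset.prod_const, Finset.prod_const_one, mul_one]
      congr 1
      rw [show (Finset.range m).filter (· < lam.colLen j) = Finset.range (lam.colLen j) by
        ext; simp; omega, Finset.card_range]
  · intro i _
    rw [Finset.prod_eq_one, Finset.prod_eq_one, mul_one]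
    · intro j _
      split_ifs with h1 h2
      · rfl
      · exact absurd (position_inr_lt_inr hm hp h1) h2
      · rfl
    · intro j _
      rw [if_neg]
      rw [Fin.lt_def, Fin.val_castAdd, Fin.val_natAdd]
      omega

/-- The determinant of a matrix rearranged by the positions of two Young diagrams. -/
theorem det_submatrix_positionEquiv {S : Type*} [CommRing S] {mu : YoungDiagram}
    (hm' : mu.colLen 0 ≤ m) (hp' : mu.rowLen 0 ≤ p) (A : Matrix (Fin (m + p)) (Fin (m + p)) S) :
    (A.submatrix (positionEquiv hm hp) (positionEquiv hm' hp')).det =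
      (∏ j : Fin p, (-1) ^ lam.colLen j) * (∏ j : Fin p, (-1) ^ mu.colLen j) * A.det := by
  rw [← Matrix.det_submatrix_equiv_self finSumFinEquiv.symm, Matrix.submatrix_submatrix]
  have h1 := Matrix.det_permute (finSumFinEquiv.symm.trans (positionEquiv hm hp))
    (A.submatrix id (finSumFinEquiv.symm.trans (positionEquiv hm' hp')))
  rw [Matrix.det_permute', Matrix.submatrix_submatrix, sign_positionEquiv, sign_positionEquiv] at h1
  refine Eq.trans h1 ?_
  have hsq : (((∏ i : Fin m, ∏ _j ∈ Finset.Ioi i, (-1 : ℤˣ) : ℤˣ) : ℤ) : S) *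
      (((∏ i : Fin m, ∏ _j ∈ Finset.Ioi i, (-1 : ℤˣ) : ℤˣ) : ℤ) : S) = 1 := by
    rw [← Int.cast_mul, ← Units.val_mul, Int.units_mul_self]
    simp
  simp only [Units.val_mul, Int.cast_mul]
  have hc : ∀ nu : YoungDiagram, (((∏ j : Fin p, (-1 : ℤˣ) ^ nu.colLen j : ℤˣ) : ℤ) : S) =
      ∏ j : Fin p, (-1) ^ nu.colLen j := fun nu => by
    simp [Units.coe_prod]
  rw [hc, hc]
  linear_combination ((∏ j : Fin p, (-1 : S) ^ lam.colLen j) *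
    (∏ j : Fin p, (-1) ^ mu.colLen j) * A.det) * hsq

end YoungDiagram

/-! ### The dual Jacobi–Trudi identity. -/

namespace FactorialSchur

open YoungDiagram

variable {R : Type*} [CommRing R] (n : ℕ)

/-- The `p × p` matrix `(e_{λ'_i - μ'_j - i + j}(x | τ^{-μ'_j + j - 1} a))`. -/
noncomputable def eMatrix (lam mu : YoungDiagram) (a : ℤ → R) (p : ℕ) :
    Matrix (Fin p) (Fin p) (MvPolynomial (Fin n) R) :=
  Matrix.of fun i j : Fin p =>
    e n ((lam.colLen i : ℤ) - mu.colLen j - ((i : ℤ) + 1) + ((j : ℤ) + 1))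
      (shift (-(mu.colLen j : ℤ) + ((j : ℤ) + 1) - 1) a)

/-- The dual Jacobi–Trudi identity for skew factorial Schur polynomials. -/
theorem skewFactorialSchur_eq_det_eMatrix [Nontrivial R] (a : ℤ → R) (lam mu : YoungDiagram)
    {p : ℕ} (hlam : lam.rowLen 0 ≤ p) (hmu : mu.rowLen 0 ≤ p) :
    skewFactorialSchur n lam mu a = (eMatrix n lam mu a p).det := by
  obtain ⟨m, hm, hm'⟩ : ∃ m, lam.colLen 0 ≤ m ∧ mu.colLen 0 ≤ m :=
    ⟨_, le_max_left _ _, le_max_right _ _⟩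
  rw [skewFactorialSchur_eq n lam mu a m hm hm']
  have key := Matrix.det_submatrix_eq_of_mul_eq_one
    (mul_eq_one_comm.mp (eTruncation_mul_hTruncation n a m (m + p)))
    (positionEquiv hm hlam) (positionEquiv hm' hmu)
  rw [det_submatrix_positionEquiv, det_hTruncation, mul_one] at key
  have hH : (hTruncation n a m (m + p)).submatrix (positionEquiv hm hlam ∘ Sum.inl)
      (positionEquiv hm' hmu ∘ Sum.inl) = hMatrix n lam mu a m := by
    ext1 i j
    simp only [hTruncation, hMatrix, positionEquiv, position, Matrix.submatrix_apply,
      Matrix.of_apply, Function.comp_apply, Equiv.ofBijective_apply, Sum.elim_inl]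
    have := i.isLt
    have := j.isLt
    congr 2 <;> omega
  -- Jacobi's identity swaps the roles of rows and columns: μ now indexes rows and λ columns, so the
  -- transpose of the e-matrix appears, with a sign for each row and each column.
  have hE : (eTruncation n a m (m + p)).submatrix (positionEquiv hm' hmu ∘ Sum.inr)
      (positionEquiv hm hlam ∘ Sum.inr) = Matrix.of fun i j : Fin p =>
        (-1) ^ (m + i - mu.colLen i) *
        ((-1) ^ (m + j - lam.colLen j) * eMatrix n lam mu a p j i) := by
    ext1 i j
    simp only [eTruncation, eMatrix, positionEquiv, position, Matrix.submatrix_apply,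
      Matrix.of_apply, Function.comp_apply, Equiv.ofBijective_apply, Sum.elim_inr]
    have := colLen_le hm j
    have := colLen_le hm' i
    rw [pow_add, mul_assoc]
    congr 4 <;> omega
  -- The permutation sign ν'_j and the entry sign m + j - ν'_j add up to m + j, independent of ν;
  -- the contributions of λ and μ therefore cancel.
  have hsign : ∀ nu : YoungDiagram, nu.colLen 0 ≤ m →
      (∏ j : Fin p, (-1 : MvPolynomial (Fin n) R) ^ nu.colLen j) *
        ∏ j : Fin p, (-1) ^ (m + j - nu.colLen j) = ∏ j : Fin p, (-1) ^ (m + j : ℕ) := by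
    intro nu hnu
    rw [← Finset.prod_mul_distrib]
    refine Finset.prod_congr rfl fun j _ => ?_
    have := colLen_le hnu j
    rw [← pow_add]
    congr 1
    omega
  have hsq : (∏ j : Fin p, (-1 : MvPolynomial (Fin n) R) ^ (m + j : ℕ)) *
      ∏ j : Fin p, (-1) ^ (m + j : ℕ) = 1 := by
    rw [← Finset.prod_mul_distrib]
    refine Finset.prod_eq_one fun j _ => ?_
    rw [← pow_add, ← two_mul, pow_mul, neg_one_sq, one_pow]
  rw [hH, hE] at key
  rw [key]
  have hdet : (Matrix.of fun i j : Fin p => (-1) ^ (m + i - mu.colLen i) *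
      ((-1) ^ (m + j - lam.colLen j) * eMatrix n lam mu a p j i)).det =
      (∏ i : Fin p, (-1) ^ (m + i - mu.colLen i)) * ((∏ j : Fin p, (-1) ^ (m + j - lam.colLen j)) *
        (eMatrix n lam mu a p).det) := by
    rw [← Matrix.det_transpose (eMatrix n lam mu a p), ← Matrix.det_mul_row, ← Matrix.det_mul_column]
    rfl
  rw [hdet]
  have h1 := hsign lam hm
  have h2 := hsign mu hm'
  calc _ = ((∏ j : Fin p, (-1 : MvPolynomial (Fin n) R) ^ lam.colLen j) *
        ∏ j : Fin p, (-1) ^ (m + j - lam.colLen j)) *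
        ((∏ j : Fin p, (-1 : MvPolynomial (Fin n) R) ^ mu.colLen j) *
        ∏ j : Fin p, (-1) ^ (m + j - mu.colLen j)) * (eMatrix n lam mu a p).det := by ring
    _ = (eMatrix n lam mu a p).det := by rw [h1, h2, hsq, one_mul]

end FactorialSchur

theorem mainTheorem2 {R : Type*} [CommRing R] (n : ℕ) (a : ℤ → R) (lam mu : YoungDiagram) :
    (∀ p : ℕ, lam.rowLen 0 ≤ p → mu.rowLen 0 ≤ p →
      FactorialSchur.skewFactorialSchur n lam mu a =
        Matrix.det (Matrix.of fun i j : Fin p =>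
          FactorialSchur.e n ((lam.colLen i : ℤ) - mu.colLen j - ((i : ℤ) + 1) + ((j : ℤ) + 1))
            (FactorialSchur.shift (-(mu.colLen j : ℤ) + ((j : ℤ) + 1) - 1) a))) ∧
    (lam.colLen 0 ≤ n → ∀ p : ℕ, lam.rowLen 0 ≤ p →
      FactorialSchur.factorialSchur n lam a =
        Matrix.det (Matrix.of fun i j : Fin p =>
          FactorialSchur.e n ((lam.colLen i : ℤ) - ((i : ℤ) + 1) + ((j : ℤ) + 1))
            (FactorialSchur.shift (((j : ℤ) + 1) - 1) a))) := by
  -- The degree arguments need 1 ≠ 0; over the zero ring both identities are trivial.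
  rcases subsingleton_or_nontrivial R with hR | hR
  · exact ⟨fun _ _ _ => Subsingleton.elim _ _, fun _ _ _ => Subsingleton.elim _ _⟩
  refine ⟨fun p hlam hmu => FactorialSchur.skewFactorialSchur_eq_det_eMatrix n a lam mu hlam hmu,
    fun hn p hlam => ?_⟩
  rw [FactorialSchur.skewFactorialSchur_bot n a lam hn,
    FactorialSchur.skewFactorialSchur_eq_det_eMatrix n a lam ⊥ hlam
      (by rw [FactorialSchur.rowLen_bot]; exact Nat.zero_le p)]
  simp [FactorialSchur.eMatrix, FactorialSchur.colLen_bot]
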